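/- Throughout, $\Bbbk$ is an infinite field. A simplicial complex on a finite set $V$ is a family of subsets of $V$ closed under taking subsets; $\dim\sigma=|\sigma|-1$; $V(\Delta)=\{v:\{v\}\in\Delta\}$ is the vertex set and $f_0(\Delta)=|V(\Delta)|$. The complex $\Delta$ is Cohen--Macaulay (CM) if its face ring $\Bbbk[\Delta]=\Bbbk[x_v:v\in V]/\langle \prod_{v\in\tau}x_v:\tau\notin\Delta\rangle$ has depth (the maximal length of a regular sequence of homogeneous polynomials) equal to its Krull dimension. A subcomplex $\Gamma\subseteq\Delta$ is full if every face of $\Delta$ all of whose vertices lie in $V(\Gamma)$ is a face of $\Gamma$; a full arrangement in $\Delta$ is a finite family of full subcomplexes. For a subcomplex $\Gamma\subsetneq\Delta$ put $d'=\dim(\Delta,\Gamma)+1=\max\{|\sigma|:\sigma\in\Delta\setminus\Gamma\}$, let $f_{j-1}(\Delta,\Gamma)$ be the number of $\sigma\in\Delta\setminus\Gamma$ with $|\sigma|=j$, and define $h_k(\Delta,\Gamma)$ by $\sum_k h_k(\Delta,\Gamma)t^k=\sum_{j=0}^{d'}f_{j-1}(\Delta,\Gamma)\,t^j(1-t)^{d'-j}$.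 Binomial coefficients are $\binom{x}{k}=x(x-1)\cdots(x-k+1)/k!$ for all integers $x$ and $k\ge0$. A non-face of $\Delta$ is a subset of $V(\Delta)$ that is not a face of $\Delta$. \textbf{Theorem.} Let $\Delta$ be a $(d-1)$-dimensional Cohen--Macaulay complex and let $\Gamma_1,\dots,\Gamma_m$, $m\ge1$, be a full arrangement in $\Delta$ of pairwise disjoint (i.e.\ with no common face other than $\emptyset$) Cohen--Macaulay subcomplexes of codimension one, that is, of dimension $d-2$. Then for all $0\le k\le d$ $$h_k\Bigl(\Delta,\bigcup_{i=1}^m\Gamma_i\Bigr)\ \le\ \binom{f_0(\Delta)-d+k-1}{k}-\sum_{i=1}^m\binom{f_0(\Gamma_i)-d+k-1}{k}+(m-1)\binom{-d+k-1}{k}.$$ Moreover, for each $0\le k_0\le d$, equality holds for $k=k_0$ if and only if every non-face $\sigma$ of $\Delta$ with $\dim\sigma<k_0$ is supported on some $\Gamma_i$, i.e.\ $\sigma\subseteq V(\Gamma_i)$ for some $i$. -/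

import Mathlib

namespace RelSR

universe u v

/-- A simplicial complex on the ground set `V`: a family of finite subsets of `V` that is closed
under taking subsets.  The void complex `⊥` (no faces) is allowed; every other complex contains
the empty face. `Γ ≤ Δ` says that `Γ` is a subcomplex of `Δ`, and `⨆` is the union of complexes. -/
abbrev Complex (V : Type u) : Type u := LowerSet (Finset V)

section Combinatorics

variable {V : Type u}

/-- The vertices of a simplicial complex. -/
def vertices (Δ : Complex V) : Set V := {v | {v} ∈ Δ}

/-- `HasDim Δ e`: the maximal dimension `|σ| - 1` of a face `σ` of `Δ` is `e`
(no `e` satisfies this for the void complex). -/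
def HasDim (Δ : Complex V) (e : ℤ) : Prop :=
  IsGreatest {j : ℤ | ∃ σ ∈ Δ, j = (σ.card : ℤ) - 1} e

/-- The faces of the relative complex `(Δ, Γ)`. -/
def relFaces (Δ Γ : Complex V) : Set (Finset V) := {σ | σ ∈ Δ ∧ σ ∉ Γ}

/-- The number `f_{j-1}(Δ, Γ)` of faces of `(Δ, Γ)` with `j` elements. -/
noncomputable def numFaces (Δ Γ : Complex V) (j : ℕ) : ℕ :=
  {σ | σ ∈ relFaces Δ Γ ∧ σ.card = j}.ncard

/-- `dim (Δ, Γ) + 1`, the maximal number of elements of a face of `(Δ, Γ)`. -/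
noncomputable def rank (Δ Γ : Complex V) : ℕ :=
  sSup {j : ℕ | ∃ σ ∈ relFaces Δ Γ, σ.card = j}

open Polynomial in
/-- The `h`-polynomial `∑ f_{j-1} t^j (1-t)^{d-j}` of `(Δ, Γ)`, where `d = dim (Δ, Γ) + 1`; it is
the numerator of the Hilbert series of the face module written over `(1-t)^d`. -/
noncomputable def hPoly (Δ Γ : Complex V) : ℤ[X] :=
  ∑ j ∈ Finset.range (rank Δ Γ + 1),
    (numFaces Δ Γ j : ℤ[X]) * X ^ j * (1 - X) ^ (rank Δ Γ - j)

/-- The entry `h_k(Δ, Γ)` of the `h`-vector of `(Δ, Γ)`. -/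
noncomputable def hNum (Δ Γ : Complex V) (k : ℕ) : ℤ := (hPoly Δ Γ).coeff k

/-- `Γ` is a full (induced) subcomplex of `Δ`. -/
def IsFull (Δ Γ : Complex V) : Prop :=
  Γ ≤ Δ ∧ ∀ σ ∈ Δ, (∀ v ∈ σ, v ∈ vertices Γ) → σ ∈ Γ

/-- A full arrangement in `Δ`: a finite family of full subcomplexes. -/
def IsFullArrangement {m : ℕ} (Δ : Complex V) (Γ : Fin m → Complex V) : Prop :=
  ∀ i, IsFull Δ (Γ i)

/-- Two complexes are disjoint if they have no common face except possibly the empty one. -/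
def AreDisjoint (Γ Γ' : Complex V) : Prop :=
  ∀ σ, σ ∈ Γ → σ ∈ Γ' → σ = ∅

/-- A non-face of `Δ`: a set of vertices of `Δ` that is not a face of `Δ`. -/
def IsNonFace (Δ : Complex V) (σ : Finset V) : Prop :=
  (∀ v ∈ σ, v ∈ vertices Δ) ∧ σ ∉ Δ

end Combinatorics

section Algebra

/-- The Stanley–Reisner ideal of `Δ`, generated by the monomials `x^τ` with `τ ∉ Δ`. -/
noncomputable def faceIdeal (k : Type v) [Field k] {V : Type u} (Δ : Complex V) : Ideal (MvPolynomial V k) :=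
  Ideal.span {p | ∃ τ : Finset V, τ ∉ Δ ∧ p = ∏ v ∈ τ, MvPolynomial.X v}

/-- The face ring `k[Δ]`, which is used below as a module over the polynomial ring. -/
noncomputable abbrev faceRing (k : Type v) [Field k] {V : Type u} (Δ : Complex V) : Type (max u v) := MvPolynomial V k ⧸ faceIdeal k Δ

/-- The depth of a (graded) module over a polynomial ring: the supremum of the lengths of the
regular sequences that consist of homogeneous polynomials. -/
noncomputable def depth (k : Type v) [Field k] (V : Type u)
    (M : Type*) [AddCommGroup M] [Module (MvPolynomial V k) M] :
    WithBot ℕ∞ :=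
  ⨆ Θ : {Θ : List (MvPolynomial V k) //
      (∀ θ ∈ Θ, ∃ e : ℕ, θ.IsHomogeneous e) ∧ RingTheory.Sequence.IsRegular M Θ},
    (Θ.1.length : WithBot ℕ∞)

/-- `Δ` is Cohen–Macaulay over `k`: the depth of `k[Δ]` equals its Krull dimension. -/
def IsCM (k : Type v) [Field k] {V : Type u} (Δ : Complex V) : Prop :=
  depth k V (faceRing k Δ) = Module.supportDim (MvPolynomial V k) (faceRing k Δ)

end Algebra

end RelSR

/-! Let T be the simplex on V(Δ), F_i the simplex on V(Γ_i), and D = Δ ∪ ⋃ F_i. Counting faces with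
weight t^|σ| (1-t)^(d-|σ|) identifies the right-hand side minus h_k with the t^k-coefficient of P =
(1-t)^d · Hilb(I_D / I_T) (`choose_sub_hNum_eq_coeff`, `hilbertDiff_faceIdeal`).

The key point is that I_D / I_T has depth at least d + 1, one more than the exponent in P
(`extVanish_arrangement`). By Cohen–Macaulayness I_Δ / I_T has depth at least d + 1 and I_{Γ_i} /
I_{F_i} depth at least d. Fullness and disjointness say that F_i is glued on exactly along Γ_i, so
the depth lemma preserves the bound d + 1 (`extVanish_sup`). Depth is expressed by vanishing of Ext
out of the residue field, which passes easily through exact sequences.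

Over an infinite field, regular linear forms can be divided out one at a time, each multiplying the
Hilbert series by 1 - t; hence (1-t)P has nonnegative coefficients (`coeff_hilbertDiff_nonneg`). So
the coefficients of P are nonnegative, which is the inequality, and nondecreasing. The k-th one
therefore vanishes only if all earlier ones do, that is, if (T, D) has no face with at most k
elements; this is the equality criterion. -/

open CategoryTheory Abelian Pointwise

namespace RelSR

/-! ### Depth via Ext vanishing. -/

section ExtVanishing

universe w

variable {R : Type w} [CommRing R]

/-- The groups `Ext^i(K, M)` vanish for `i < r`.  When `K` is the residue field of a graded ring
this is the homological form of `depth M ≥ r`. -/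
def ExtVanish (K : Type w) [AddCommGroup K] [Module R K] (r : ℕ)
    (M : Type w) [AddCommGroup M] [Module R M] : Prop :=
  ∀ i < r, Subsingleton (Ext (ModuleCat.of R K) (ModuleCat.of R M) i)

variable {K : Type w} [AddCommGroup K] [Module R K]
variable {M M₁ M₂ M₃ : Type w} [AddCommGroup M] [Module R M] [AddCommGroup M₁] [Module R M₁]
  [AddCommGroup M₂] [Module R M₂] [AddCommGroup M₃] [Module R M₃]

lemma ExtVanish.mono {r s : ℕ} (h : ExtVanish (R := R) K r M) (hs : s ≤ r) :
    ExtVanish (R := R) K s M := fun i hi => h i (hi.trans_le hs)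

lemma ExtVanish.of_subsingleton [Subsingleton M] (r : ℕ) : ExtVanish (R := R) K r M := by
  intro i _
  refine subsingleton_of_forall_eq 0 fun x => ?_
  have h : 𝟙 (ModuleCat.of R M) = 0 := by
    ext y
    exact Subsingleton.elim (α := M) _ _
  rw [← Ext.comp_mk₀_id x, h, Ext.mk₀_zero, Ext.comp_zero]

/-- The depth lemma: in the long exact sequence, Ext^i of the left term sits between Ext^(i-1) of
the right term and Ext^i of the middle term. -/
lemma ExtVanish.of_exact {f : M₁ →ₗ[R] M₂} {g : M₂ →ₗ[R] M₃} (hf : Function.Injective f)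
    (hg : Function.Surjective g) (hfg : Function.Exact f g) {r : ℕ}
    (h₂ : ExtVanish (R := R) K (r + 1) M₂) (h₃ : ExtVanish (R := R) K r M₃) :
    ExtVanish (R := R) K (r + 1) M₁ := by
  let T := ModuleCat.shortComplexOfCompEqZero f g hfg.linearMap_comp_eq_zero
  have hT : T.ShortExact :=
    { exact := ModuleCat.shortComplex_exact _ hfg
      mono_f := (ModuleCat.mono_iff_injective _).mpr hf
      epi_g := (ModuleCat.epi_iff_surjective _).mpr hg }
  intro i hi
  refine subsingleton_of_forall_eq 0 fun x => ?_
  have := h₂ i hi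
  rcases i with _ | i
  · have := Ext.postcomp_mk₀_injective_of_mono (ModuleCat.of R K) T.f (hf := hT.mono_f)
    exact this (Subsingleton.elim (α := Ext (ModuleCat.of R K) (ModuleCat.of R M₂) 0) _ _)
  · obtain ⟨y, hy⟩ := Ext.covariant_sequence_exact₁ (ModuleCat.of R K) hT x
      (Subsingleton.elim (α := Ext (ModuleCat.of R K) (ModuleCat.of R M₂) (i + 1)) _ _) rfl
    have := h₃ i (by omega)
    rw [← hy, Subsingleton.elim (α := Ext (ModuleCat.of R K) (ModuleCat.of R M₃) i) y 0,
      Ext.zero_comp]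

lemma ExtVanish.of_equiv (e : M₁ ≃ₗ[R] M₂) {r : ℕ} (h : ExtVanish (R := R) K r M₁) :
    ExtVanish (R := R) K r M₂ := by
  rcases r with _ | r
  · intro i hi
    omega
  · refine ExtVanish.of_exact (f := e.symm.toLinearMap) (g := (0 : M₁ →ₗ[R] PUnit.{w + 1}))
      e.symm.injective (fun y => ⟨0, Subsingleton.elim _ _⟩) (fun x => ?_) h
      (ExtVanish.of_subsingleton r)
    simp

/-- Since y kills K, it acts as zero on Ext(K, M), so every class in Ext^(i+1)(K, M) comes from
Ext^i(K, M/yM) by the connecting map. -/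
lemma ExtVanish.succ_of_isSMulRegular {y : R} (hy : y ∈ Module.annihilator R K)
    (hreg : IsSMulRegular M y) {r : ℕ} (h : ExtVanish (R := R) K r (QuotSMulTop y M)) :
    ExtVanish (R := R) K (r + 1) M := by
  intro i hi
  refine subsingleton_of_forall_eq 0 fun x => ?_
  have hzero : x.comp (Ext.mk₀ (y • 𝟙 (ModuleCat.of R M))) (add_zero i) = 0 := by
    have := Ext.postcomp_smul_id_eq_zero_of_mem_annihilator (M := ModuleCat.of R M)
      (N := ModuleCat.of R K) hy i
    exact congrArg (fun φ => φ.hom x) this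
  have hT := IsSMulRegular.smulShortComplex_shortExact (M := ModuleCat.of R M) hreg
  rcases i with _ | i
  · have := Ext.postcomp_mk₀_injective_of_mono (ModuleCat.of R K) _ (hf := hT.mono_f)
    exact this (hzero.trans (map_zero _).symm)
  · obtain ⟨z, hz⟩ := Ext.covariant_sequence_exact₁ (ModuleCat.of R K) hT x hzero rfl
    have := h i (by omega)
    have hz0 : z = 0 := Subsingleton.elim
      (α := Ext (ModuleCat.of R K) (ModuleCat.of R (QuotSMulTop y M)) i) z 0
    rw [← hz, hz0, Ext.zero_comp]
    rfl

lemma ExtVanish.quotSMulTop {y : R} (hreg : IsSMulRegular M y) {r : ℕ}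
    (h : ExtVanish (R := R) K (r + 1) M) : ExtVanish (R := R) K r (QuotSMulTop y M) := by
  intro i hi
  refine subsingleton_of_forall_eq 0 fun x => ?_
  have hT := IsSMulRegular.smulShortComplex_shortExact (M := ModuleCat.of R M) hreg
  have h0 := h i (by omega)
  have h1 := h (i + 1) (by omega)
  obtain ⟨z, hz⟩ := Ext.covariant_sequence_exact₃ (ModuleCat.of R K) hT x rfl
    (Subsingleton.elim (α := Ext (ModuleCat.of R K) (ModuleCat.of R M) (i + 1)) _ _)
  have hz0 : z = 0 := Subsingleton.elim (α := Ext (ModuleCat.of R K) (ModuleCat.of R M) i) z 0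
  rw [← hz, hz0, Ext.zero_comp]
  rfl

lemma ExtVanish.of_isWeaklyRegular (Θ : List R) (hΘ : ∀ θ ∈ Θ, θ ∈ Module.annihilator R K)
    {M : Type w} [AddCommGroup M] [Module R M]
    (h : RingTheory.Sequence.IsWeaklyRegular M Θ) : ExtVanish (R := R) K Θ.length M := by
  induction Θ generalizing M with
  | nil => intro i hi; simp at hi
  | cons θ Θ ih =>
    rw [RingTheory.Sequence.isWeaklyRegular_cons_iff] at h
    exact ExtVanish.succ_of_isSMulRegular (hΘ θ List.mem_cons_self) h.1
      (ih (fun x hx => hΘ x (List.mem_cons_of_mem _ hx)) h.2)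

lemma ExtVanish.subsingleton_linearMap {r : ℕ} (h : ExtVanish (R := R) K (r + 1) M) :
    Subsingleton (K →ₗ[R] M) :=
  have := h 0 (by omega)
  (Ext.addEquiv₀.trans (ModuleCat.homAddEquiv (M := ModuleCat.of R K)
    (N := ModuleCat.of R M))).symm.subsingleton

/-- The subquotient `B / (A ∩ B)` of a module. -/
abbrev Subquot (A B : Submodule R M) : Type w := ↥B ⧸ A.submoduleOf B

/-- The depth lemma for 0 → B/A → C/A → C/B → 0. -/
lemma ExtVanish.subquot_left {A B C : Submodule R M} (hAB : A ≤ B) (hBC : B ≤ C) {r : ℕ}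
    (h₂ : ExtVanish (R := R) K (r + 1) (Subquot A C)) (h₃ : ExtVanish (R := R) K r (Subquot B C)) :
    ExtVanish (R := R) K (r + 1) (Subquot A B) := by
  let f : Subquot A B →ₗ[R] Subquot A C :=
    Submodule.mapQ _ _ (Submodule.inclusion hBC) fun x hx => hx
  let g : Subquot A C →ₗ[R] Subquot B C := Submodule.mapQ _ _ LinearMap.id fun x hx => hAB hx
  refine ExtVanish.of_exact (f := f) (g := g) ?_ ?_ ?_ h₂ h₃
  · rw [injective_iff_map_eq_zero]
    intro x hx
    obtain ⟨x, rfl⟩ := Submodule.Quotient.mk_surjective _ x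
    erw [Submodule.mapQ_apply, Submodule.Quotient.mk_eq_zero] at hx
    exact (Submodule.Quotient.mk_eq_zero _).mpr hx
  · intro x
    obtain ⟨x, rfl⟩ := Submodule.Quotient.mk_surjective _ x
    exact ⟨Submodule.Quotient.mk x, rfl⟩
  · intro x
    obtain ⟨x, rfl⟩ := Submodule.Quotient.mk_surjective _ x
    constructor
    · intro hx
      erw [Submodule.mapQ_apply, Submodule.Quotient.mk_eq_zero] at hx
      exact ⟨Submodule.Quotient.mk ⟨x, hx⟩, rfl⟩
    · rintro ⟨y, hy⟩
      obtain ⟨y, rfl⟩ := Submodule.Quotient.mk_surjective _ y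
      rw [← hy]
      exact (Submodule.Quotient.mk_eq_zero _).mpr y.2

lemma ExtVanish.subquot_sup {A B : Submodule R M} {r : ℕ}
    (h : ExtVanish (R := R) K r (Subquot B (A ⊔ B))) :
    ExtVanish (R := R) K r (Subquot (A ⊓ B) A) :=
  h.of_equiv (LinearMap.quotientInfEquivSupQuotient A B).symm

lemma ExtVanish.subquot_top {A : Submodule R M} {r : ℕ} :
    ExtVanish (R := R) K r (Subquot A ⊤) ↔ ExtVanish (R := R) K r (M ⧸ A) := by
  have e : Subquot A ⊤ ≃ₗ[R] M ⧸ A :=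
    Submodule.Quotient.equiv _ _ Submodule.topEquiv (by ext x; simp [Submodule.submoduleOf])
  exact ⟨fun h => h.of_equiv e, fun h => h.of_equiv e.symm⟩

lemma ExtVanish.subquot_self (A : Submodule R M) (r : ℕ) :
    ExtVanish (R := R) K r (Subquot A A) := by
  have : Subsingleton (Subquot A A) := by
    rw [Submodule.Quotient.subsingleton_iff]
    simp
  exact ExtVanish.of_subsingleton r

end ExtVanishing

/-! ### Linear regular elements and Hilbert series. -/

section HilbertSeries

universe u v

open MvPolynomial

variable {V : Type u} {𝕜 : Type v} [Field 𝕜]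

/-- The elements of degree `j` of an ideal of the polynomial ring. -/
noncomputable def gradedPiece (A : Ideal (MvPolynomial V 𝕜)) (j : ℕ) :
    Submodule 𝕜 (MvPolynomial V 𝕜) :=
  A.restrictScalars 𝕜 ⊓ homogeneousSubmodule V 𝕜 j

lemma mem_gradedPiece {A : Ideal (MvPolynomial V 𝕜)} {j : ℕ} {x : MvPolynomial V 𝕜} :
    x ∈ gradedPiece A j ↔ x ∈ A ∧ x.IsHomogeneous j := Iff.rfl

instance [Finite V] (j : ℕ) : FiniteDimensional 𝕜 (homogeneousSubmodule V 𝕜 j) :=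
  Module.Finite.iff_fg.mpr (homogeneousSubmodule_fg V 𝕜 j)

instance [Finite V] (A : Ideal (MvPolynomial V 𝕜)) (j : ℕ) :
    FiniteDimensional 𝕜 (gradedPiece A j) :=
  Submodule.finiteDimensional_of_le (inf_le_right : _ ≤ homogeneousSubmodule V 𝕜 j)

/-- The Hilbert series of `B / A` for homogeneous ideals `A ≤ B`. -/
noncomputable def hilbertDiff (A B : Ideal (MvPolynomial V 𝕜)) : PowerSeries ℤ :=
  PowerSeries.mk fun j =>
    (Module.finrank 𝕜 (gradedPiece B j) : ℤ) - Module.finrank 𝕜 (gradedPiece A j)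

attribute [local instance] MvPolynomial.gradedAlgebra

/-- Homogeneous ideals of the polynomial ring with its standard grading. -/
def IsHomog (A : Ideal (MvPolynomial V 𝕜)) : Prop :=
  A.IsHomogeneous (homogeneousSubmodule V 𝕜)

lemma IsHomog.sup_span_mul {A B : Ideal (MvPolynomial V 𝕜)} (hA : IsHomog A) (hB : IsHomog B)
    {θ : MvPolynomial V 𝕜} (hθ : θ.IsHomogeneous 1) : IsHomog (A ⊔ Ideal.span {θ} * B) := by
  refine Ideal.IsHomogeneous.sup hA (Ideal.IsHomogeneous.mul ?_ hB)
  refine Ideal.homogeneous_span _ _ ?_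
  rintro x rfl
  exact ⟨1, hθ⟩

lemma gradedPiece_zero_sup_span_mul {A B : Ideal (MvPolynomial V 𝕜)} (hA : IsHomog A)
    {θ : MvPolynomial V 𝕜} (hθ : θ.IsHomogeneous 1) :
    gradedPiece (A ⊔ Ideal.span {θ} * B) 0 = gradedPiece A 0 := by
  refine le_antisymm ?_ (inf_le_inf_right _ fun x hx => Ideal.mem_sup_left hx)
  rintro x ⟨hx, hxj⟩
  obtain ⟨a, ha, y, hy, rfl⟩ := Submodule.mem_sup.mp hx
  obtain ⟨b, hb, rfl⟩ := Ideal.mem_span_singleton_mul.mp hy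
  refine mem_gradedPiece.mpr ⟨?_, hxj⟩
  have h := DirectSum.decompose_of_mem_same (homogeneousSubmodule V 𝕜) hxj
  rw [DirectSum.decompose_add, DirectSum.add_apply, Submodule.coe_add,
    DirectSum.coe_decompose_mul_of_left_mem_of_not_le (homogeneousSubmodule V 𝕜) (i := 1)
      (a := θ) hθ (by simp), add_zero] at h
  rw [← h]
  exact hA 0 ha

lemma gradedPiece_succ_sup_span_mul {A B : Ideal (MvPolynomial V 𝕜)} (hA : IsHomog A)
    (hB : IsHomog B) {θ : MvPolynomial V 𝕜} (hθ : θ.IsHomogeneous 1) (j : ℕ) :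
    gradedPiece (A ⊔ Ideal.span {θ} * B) (j + 1) =
      gradedPiece A (j + 1) ⊔ (gradedPiece B j).map (LinearMap.mulLeft 𝕜 θ) := by
  refine le_antisymm ?_ (sup_le (inf_le_inf_right _ fun x hx => Ideal.mem_sup_left hx) ?_)
  · rintro x ⟨hx, hxj⟩
    obtain ⟨a, ha, y, hy, rfl⟩ := Submodule.mem_sup.mp hx
    obtain ⟨b, hb, rfl⟩ := Ideal.mem_span_singleton_mul.mp hy
    have h := DirectSum.decompose_of_mem_same (homogeneousSubmodule V 𝕜) hxj
    rw [DirectSum.decompose_add, DirectSum.add_apply, Submodule.coe_add,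
      DirectSum.coe_decompose_mul_of_left_mem_of_le (homogeneousSubmodule V 𝕜) (i := 1)
        (a := θ) hθ (by omega), Nat.add_sub_cancel] at h
    rw [← h]
    refine Submodule.add_mem_sup ⟨hA _ ha, SetLike.coe_mem _⟩ ⟨_, ⟨hB j hb, SetLike.coe_mem _⟩, ?_⟩
    simp
  · rintro _ ⟨b, ⟨hb, hbj⟩, rfl⟩
    refine mem_gradedPiece.mpr ⟨Ideal.mem_sup_right ?_, ?_⟩
    · exact Ideal.mem_span_singleton_mul.mpr ⟨b, hb, rfl⟩
    · rw [add_comm]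
      exact hθ.mul hbj

/-- The degree j + 1 part of A + θB is A_{j+1} + θB_j, and regularity of θ on B/A gives A_{j+1} ∩
θB_j = θA_j; the rest is the dimension formula for a sum. -/
lemma finrank_gradedPiece_succ [Finite V] {A B : Ideal (MvPolynomial V 𝕜)} (hAB : A ≤ B)
    (hA : IsHomog A) (hB : IsHomog B) {θ : MvPolynomial V 𝕜} (hθ : θ.IsHomogeneous 1)
    (hreg : ∀ x ∈ B, θ * x ∈ A → x ∈ A) (j : ℕ) :
    Module.finrank 𝕜 (gradedPiece (A ⊔ Ideal.span {θ} * B) (j + 1)) +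
        Module.finrank 𝕜 (gradedPiece A j) =
      Module.finrank 𝕜 (gradedPiece A (j + 1)) + Module.finrank 𝕜 (gradedPiece B j) := by
  by_cases h0 : θ = 0
  -- The zero form can be regular only on the zero module.
  · have : A = B := le_antisymm hAB fun x hx => hreg x hx (by simp [h0])
    subst this
    rw [h0, Ideal.span_singleton_eq_bot.mpr rfl, Ideal.bot_mul, sup_bot_eq]
  · have hinj : Function.Injective (LinearMap.mulLeft 𝕜 θ) := mul_right_injective₀ h0
    have hinf : gradedPiece A (j + 1) ⊓ (gradedPiece B j).map (LinearMap.mulLeft 𝕜 θ) =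
        (gradedPiece A j).map (LinearMap.mulLeft 𝕜 θ) := by
      refine le_antisymm ?_ (le_inf ?_ (Submodule.map_mono (inf_le_inf_right _ hAB)))
      · rintro _ ⟨⟨h1, _⟩, b, ⟨hb, hbj⟩, rfl⟩
        exact ⟨b, ⟨hreg b hb h1, hbj⟩, rfl⟩
      · rintro _ ⟨b, ⟨hb, hbj⟩, rfl⟩
        refine mem_gradedPiece.mpr ⟨A.mul_mem_left θ hb, ?_⟩
        rw [add_comm]
        exact hθ.mul hbj
    have h := Submodule.finrank_sup_add_finrank_inf_eq (gradedPiece A (j + 1))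
      ((gradedPiece B j).map (LinearMap.mulLeft 𝕜 θ))
    rwa [hinf, (Submodule.equivMapOfInjective _ hinj _).symm.finrank_eq,
      (Submodule.equivMapOfInjective _ hinj _).symm.finrank_eq, ← gradedPiece_succ_sup_span_mul hA hB hθ] at h

lemma hilbertDiff_sup_span_mul [Finite V] {A B : Ideal (MvPolynomial V 𝕜)} (hAB : A ≤ B)
    (hA : IsHomog A) (hB : IsHomog B) {θ : MvPolynomial V 𝕜} (hθ : θ.IsHomogeneous 1)
    (hreg : ∀ x ∈ B, θ * x ∈ A → x ∈ A) :
    hilbertDiff (A ⊔ Ideal.span {θ} * B) B = (1 - PowerSeries.X) * hilbertDiff A B := by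
  ext j
  rw [sub_mul, one_mul, map_sub]
  rcases j with _ | j
  · simp only [hilbertDiff, PowerSeries.coeff_mk, PowerSeries.coeff_zero_X_mul, sub_zero]
    rw [gradedPiece_zero_sup_span_mul hA hθ]
  · have := finrank_gradedPiece_succ hAB hA hB hθ hreg j
    simp only [hilbertDiff, PowerSeries.coeff_mk, PowerSeries.coeff_succ_X_mul]
    push_cast [← @Nat.cast_inj ℤ] at this
    linarith

/-- The residue field of the polynomial ring at the ideal generated by the variables. -/
abbrev ResField (V : Type u) (𝕜 : Type v) [Field 𝕜] : Type (max u v) :=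
  MvPolynomial V 𝕜 ⧸ idealOfVars V 𝕜

lemma mem_annihilator_resField {y : MvPolynomial V 𝕜} :
    y ∈ Module.annihilator (MvPolynomial V 𝕜) (ResField V 𝕜) ↔ y ∈ idealOfVars V 𝕜 := by
  rw [Ideal.annihilator_quotient]

lemma exists_linear_isSMulRegular [Infinite 𝕜] [Finite V] {M : Type (max u v)} [AddCommGroup M]
    [Module (MvPolynomial V 𝕜) M] [Module.Finite (MvPolynomial V 𝕜) M]
    (h : Subsingleton (ResField V 𝕜 →ₗ[MvPolynomial V 𝕜] M)) :
    ∃ θ : MvPolynomial V 𝕜, θ.IsHomogeneous 1 ∧ IsSMulRegular M θ := by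
  by_contra! hcon
  let W := homogeneousSubmodule V 𝕜 1
  have hfin := associatedPrimes.finite (MvPolynomial V 𝕜) M
  have : Finite (associatedPrimes (MvPolynomial V 𝕜) M) := hfin
  -- If every linear form is a zero divisor, the associated primes cover the space of linear forms.
  -- Over an infinite field one of these finitely many subspaces is everything, so that prime
  -- contains all variables and yields a nonzero map from the residue field.
  have hcov : ⋃ P : associatedPrimes (MvPolynomial V 𝕜) M,
      (((P.1.restrictScalars 𝕜).comap W.subtype : Submodule 𝕜 W) : Set W) = Set.univ := by
    refine Set.eq_univ_of_forall fun θ => ?_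
    have hθ := hcon θ.1 θ.2
    have hmem : θ.1 ∈ {r : MvPolynomial V 𝕜 | IsSMulRegular M r}ᶜ := hθ
    rw [← biUnion_associatedPrimes_eq_compl_regular] at hmem
    simp only [Set.mem_iUnion] at hmem ⊢
    obtain ⟨P, hP, hθP⟩ := hmem
    exact ⟨⟨P, hP⟩, hθP⟩
  obtain ⟨⟨P, hP⟩, hPtop⟩ := Subspace.exists_eq_top_of_iUnion_eq_univ hcov
  have hle : idealOfVars V 𝕜 ≤ P := by
    rw [idealOfVars, Ideal.span_le]
    rintro _ ⟨v, rfl⟩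
    have : (⟨X v, isHomogeneous_X 𝕜 v⟩ : W) ∈ (⊤ : Submodule 𝕜 W) := trivial
    rw [← hPtop] at this
    exact this
  obtain ⟨hprime, x, hx⟩ := isAssociatedPrime_iff.mp hP
  let φ : ResField V 𝕜 →ₗ[MvPolynomial V 𝕜] M :=
    Submodule.liftQ _ (LinearMap.toSpanSingleton (MvPolynomial V 𝕜) M x) (by
      refine hle.trans ?_
      rw [hx]
      intro y hy
      simpa [Submodule.mem_colon_singleton] using hy)
  have hφ : φ = 0 := Subsingleton.elim _ _
  have hx0 : x = 0 := by
    have h1 : φ (Submodule.Quotient.mk 1) = (1 : MvPolynomial V 𝕜) • x := rfl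
    rw [← one_smul (MvPolynomial V 𝕜) x, ← h1, hφ, LinearMap.zero_apply]
  exact hprime.ne_top (by rw [hx, hx0]; ext; simp [Submodule.mem_colon_singleton])

/-- Reducing the subquotient `B / A` modulo `θ` gives the subquotient `B / (A + θB)`. -/
noncomputable def quotSMulTopSubquotEquiv {R : Type*} [CommRing R] (A B : Ideal R) (θ : R) :
    QuotSMulTop θ (Subquot A B) ≃ₗ[R] Subquot (A ⊔ Ideal.span {θ} * B) B := by
  let q : Subquot A B →ₗ[R] Subquot (A ⊔ Ideal.span {θ} * B) B :=
    Submodule.mapQ _ _ LinearMap.id fun x hx => Ideal.mem_sup_left hx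
  have hq : Function.Surjective q := by
    intro x
    obtain ⟨x, rfl⟩ := Submodule.Quotient.mk_surjective _ x
    exact ⟨Submodule.Quotient.mk x, rfl⟩
  have hker : LinearMap.ker q = θ • (⊤ : Submodule (R) (Subquot A B)) := by
    ext x
    obtain ⟨x, rfl⟩ := Submodule.Quotient.mk_surjective _ x
    rw [LinearMap.mem_ker, Submodule.mem_smul_pointwise_iff_exists]
    erw [Submodule.mapQ_apply, Submodule.Quotient.mk_eq_zero]
    constructor
    · intro hx
      obtain ⟨a, ha, y, hy, hxy⟩ := Submodule.mem_sup.mp hx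
      obtain ⟨b, hb, rfl⟩ := Ideal.mem_span_singleton_mul.mp hy
      refine ⟨Submodule.Quotient.mk ⟨b, hb⟩, trivial, ?_⟩
      rw [← Submodule.Quotient.mk_smul, eq_comm, Submodule.Quotient.eq]
      change (x : R) - θ * b ∈ A
      have : (x : R) = a + θ * b := hxy.symm
      rwa [this, add_sub_cancel_right]
    · rintro ⟨b, -, hb⟩
      obtain ⟨b, rfl⟩ := Submodule.Quotient.mk_surjective _ b
      rw [← Submodule.Quotient.mk_smul, eq_comm, Submodule.Quotient.eq] at hb
      have hb' : (x : R) - θ * b ∈ A := hb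
      refine Submodule.mem_sup.mpr ⟨_, hb', θ * b, ?_, sub_add_cancel _ _⟩
      exact Ideal.mem_span_singleton_mul.mpr ⟨b, b.2, rfl⟩
  exact (Submodule.quotEquivOfEq _ _ hker.symm).trans (q.quotKerEquivOfSurjective hq)

/-- Passing from A to A + θB with B fixed costs one unit of depth and absorbs one factor 1 - X;
after r steps the series simply counts dimensions. -/
lemma coeff_hilbertDiff_nonneg [Infinite 𝕜] [Finite V] (r : ℕ) {A B : Ideal (MvPolynomial V 𝕜)}
    (hAB : A ≤ B) (hA : IsHomog A) (hB : IsHomog B)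
    (h : ExtVanish (R := MvPolynomial V 𝕜) (ResField V 𝕜) r (Subquot A B)) (j : ℕ) :
    0 ≤ PowerSeries.coeff j ((1 - PowerSeries.X) ^ r * hilbertDiff A B) := by
  induction r generalizing A with
  | zero =>
    simp only [pow_zero, one_mul, hilbertDiff, PowerSeries.coeff_mk, sub_nonneg, Nat.cast_le]
    exact Submodule.finrank_mono (inf_le_inf_right _ hAB)
  | succ r ih =>
    obtain ⟨θ, hθ, hreg⟩ := exists_linear_isSMulRegular h.subsingleton_linearMap
    have hreg' : ∀ x ∈ B, θ * x ∈ A → x ∈ A := by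
      intro x hx hθx
      have := isSMulRegular_iff_right_eq_zero_of_smul.mp hreg
        (Submodule.Quotient.mk ⟨x, hx⟩) (by
          rw [← Submodule.Quotient.mk_smul]
          exact (Submodule.Quotient.mk_eq_zero _).mpr hθx)
      exact (Submodule.Quotient.mk_eq_zero (A.submoduleOf B)).mp this
    have hle : A ⊔ Ideal.span {θ} * B ≤ B := sup_le hAB Ideal.mul_le_right
    rw [pow_succ, mul_assoc, ← hilbertDiff_sup_span_mul hAB hA hB hθ hreg']
    refine ih hle (hA.sup_span_mul hB hθ) ?_
    exact (h.quotSMulTop hreg).of_equiv (quotSMulTopSubquotEquiv A B θ)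

end HilbertSeries

/-! ### Depth of Stanley–Reisner modules. -/

section StanleyReisner

universe u v

open MvPolynomial

variable {V : Type u} (𝕜 : Type v) [Field 𝕜]

lemma prod_X_eq_monomial (τ : Finset V) :
    ∏ v ∈ τ, (X v : MvPolynomial V 𝕜) = monomial (∑ v ∈ τ, Finsupp.single v 1) 1 := by
  rw [monomial_sum_one]
  rfl

lemma sum_single_le_iff (τ : Finset V) (m : V →₀ ℕ) :
    ∑ v ∈ τ, Finsupp.single v 1 ≤ m ↔ τ ⊆ m.support := by
  classical
  have h : ∀ w, (∑ v ∈ τ, Finsupp.single v 1 : V →₀ ℕ) w = if w ∈ τ then 1 else 0 := by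
    intro w
    simp [Finsupp.finsetSum_apply, Finsupp.single_apply]
  constructor
  · intro hle w hw
    have := hle w
    rw [h, if_pos hw] at this
    simpa using Nat.one_le_iff_ne_zero.mp this
  · intro hsub w
    rw [h]
    split_ifs with hw
    · exact Nat.one_le_iff_ne_zero.mpr (by simpa using hsub hw)
    · exact Nat.zero_le _

variable {𝕜} in
lemma mem_faceIdeal {Δ : Complex V} {f : MvPolynomial V 𝕜} :
    f ∈ faceIdeal 𝕜 Δ ↔ ∀ m ∈ f.support, m.support ∉ Δ := by
  have h : faceIdeal 𝕜 Δ = Ideal.span ((fun s => monomial s (1 : 𝕜)) ''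
      {s | ∃ τ : Finset V, τ ∉ Δ ∧ s = ∑ v ∈ τ, Finsupp.single v 1}) := by
    rw [faceIdeal]
    congr 1
    ext p
    constructor
    · rintro ⟨τ, hτ, rfl⟩
      exact ⟨_, ⟨τ, hτ, rfl⟩, (prod_X_eq_monomial 𝕜 τ).symm⟩
    · rintro ⟨_, ⟨τ, hτ, rfl⟩, rfl⟩
      exact ⟨τ, hτ, (prod_X_eq_monomial 𝕜 τ).symm⟩
  rw [h, mem_ideal_span_monomial_image]
  refine forall₂_congr fun m _ => ⟨?_, fun hm => ?_⟩
  · rintro ⟨_, ⟨τ, hτ, rfl⟩, hle⟩ hm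
    exact hτ (Δ.lower ((sum_single_le_iff τ m).mp hle) hm)
  · exact ⟨_, ⟨m.support, hm, rfl⟩, (sum_single_le_iff _ m).mpr subset_rfl⟩

lemma faceIdeal_antitone {Δ Δ' : Complex V} (h : Δ ≤ Δ') : faceIdeal 𝕜 Δ' ≤ faceIdeal 𝕜 Δ :=
  fun _ hf => mem_faceIdeal.mpr fun m hm hmΔ => mem_faceIdeal.mp hf m hm (h hmΔ)

lemma faceIdeal_sup (Δ Δ' : Complex V) :
    faceIdeal 𝕜 (Δ ⊔ Δ') = faceIdeal 𝕜 Δ ⊓ faceIdeal 𝕜 Δ' := by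
  ext f
  simp only [Submodule.mem_inf, mem_faceIdeal, LowerSet.mem_sup_iff, not_or]
  exact ⟨fun h => ⟨fun m hm => (h m hm).1, fun m hm => (h m hm).2⟩,
    fun h m hm => ⟨h.1 m hm, h.2 m hm⟩⟩

lemma faceIdeal_inf (Δ Δ' : Complex V) :
    faceIdeal 𝕜 (Δ ⊓ Δ') = faceIdeal 𝕜 Δ ⊔ faceIdeal 𝕜 Δ' := by
  refine le_antisymm (Ideal.span_le.mpr ?_)
    (sup_le (faceIdeal_antitone 𝕜 inf_le_left) (faceIdeal_antitone 𝕜 inf_le_right))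
  rintro _ ⟨τ, hτ, rfl⟩
  rw [LowerSet.mem_inf_iff, not_and_or] at hτ
  rcases hτ with hτ | hτ
  · exact Ideal.mem_sup_left (Ideal.subset_span ⟨τ, hτ, rfl⟩)
  · exact Ideal.mem_sup_right (Ideal.subset_span ⟨τ, hτ, rfl⟩)

attribute [local instance] MvPolynomial.gradedAlgebra in
lemma isHomog_faceIdeal (Δ : Complex V) : IsHomog (faceIdeal 𝕜 Δ) := by
  refine Ideal.homogeneous_span _ _ ?_
  rintro _ ⟨τ, -, rfl⟩
  exact ⟨_, IsHomogeneous.prod τ _ (fun _ => 1) fun v _ => isHomogeneous_X 𝕜 v⟩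

variable {𝕜} in
lemma degree_eq_of_isHomogeneous {f : MvPolynomial V 𝕜} {j : ℕ} (hf : f.IsHomogeneous j)
    {m : V →₀ ℕ} (hm : m ∈ f.support) : m.degree = j := by
  rw [Finsupp.degree_eq_weight_one]
  exact hf (mem_support_iff.mp hm)

lemma finrank_gradedPiece_faceIdeal [Finite V] (Δ : Complex V) (j : ℕ) :
    Module.finrank 𝕜 (gradedPiece (faceIdeal 𝕜 Δ) j) =
      {m : V →₀ ℕ | m.degree = j ∧ m.support ∉ Δ}.ncard := by
  have h : gradedPiece (faceIdeal 𝕜 Δ) j =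
      restrictSupport 𝕜 {m : V →₀ ℕ | m.degree = j ∧ m.support ∉ Δ} := by
    ext f
    rw [mem_gradedPiece, mem_faceIdeal, mem_restrictSupport_iff]
    constructor
    · rintro ⟨h1, h2⟩ m hm
      exact ⟨degree_eq_of_isHomogeneous h2 hm, h1 m hm⟩
    · intro h
      refine ⟨fun m hm => (h hm).2, ?_⟩
      intro m hm
      have := (h (mem_support_iff.mpr hm)).1
      rw [← this, Finsupp.degree_eq_weight_one]
      rfl
  rw [h, Module.finrank_eq_nat_card_basis (basisRestrictSupport 𝕜 _)]
  rfl

/-- The simplex on a set of vertices. -/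
def simplex (W : Set V) : Complex V where
  carrier := {σ | ∀ v ∈ σ, v ∈ W}
  lower' := fun _ _ h hσ v hv => hσ v (h hv)

lemma mem_simplex {W : Set V} {σ : Finset V} : σ ∈ simplex W ↔ ∀ v ∈ σ, v ∈ W := Iff.rfl

lemma le_simplex_vertices (Δ : Complex V) : Δ ≤ simplex (vertices Δ) :=
  fun _ hσ _ hv => Δ.lower (Finset.singleton_subset_iff.mpr hv) hσ

lemma faceIdeal_simplex_of_insert {W : Set V} {v : V} (hv : v ∉ W) :
    faceIdeal 𝕜 (simplex W) = faceIdeal 𝕜 (simplex (insert v W)) ⊔ Ideal.span {X v} * ⊤ := by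
  rw [Ideal.mul_top]
  refine le_antisymm (Ideal.span_le.mpr ?_) (sup_le (faceIdeal_antitone 𝕜 ?_) ?_)
  · rintro _ ⟨τ, hτ, rfl⟩
    by_cases hvτ : v ∈ τ
    · exact Ideal.mem_sup_right (Ideal.mem_span_singleton.mpr (Finset.dvd_prod_of_mem _ hvτ))
    · refine Ideal.mem_sup_left (Ideal.subset_span ⟨τ, fun h => hτ fun w hw => ?_, rfl⟩)
      exact (h w hw).resolve_left fun hwv => hvτ (hwv ▸ hw)
  · exact fun σ hσ w hw => Or.inr (hσ w hw)
  · rw [Ideal.span_singleton_le_iff_mem]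
    exact Ideal.subset_span ⟨{v}, fun h => hv (h v (Finset.mem_singleton_self v)), by simp⟩

lemma isSMulRegular_X_faceRing_simplex {W : Set V} {v : V} (hv : v ∈ W) :
    IsSMulRegular (faceRing 𝕜 (simplex W)) (X v : MvPolynomial V 𝕜) := by
  rw [isSMulRegular_iff_right_eq_zero_of_smul]
  intro x hx
  obtain ⟨f, rfl⟩ := Submodule.Quotient.mk_surjective _ x
  rw [← Submodule.Quotient.mk_smul, Submodule.Quotient.mk_eq_zero, mem_faceIdeal] at hx
  refine (Submodule.Quotient.mk_eq_zero _).mpr (mem_faceIdeal.mpr fun m hm hmW => ?_)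
  refine hx (Finsupp.single v 1 + m) ?_ fun w hw => ?_
  · rw [smul_eq_mul, mem_support_iff, coeff_X_mul]
    exact mem_support_iff.mp hm
  · by_cases hwv : w = v
    · exact hwv ▸ hv
    · refine hmW w ?_
      simpa [Finsupp.single_apply, Ne.symm hwv] using hw

lemma X_mem_annihilator_resField (v : V) :
    (X v : MvPolynomial V 𝕜) ∈ Module.annihilator (MvPolynomial V 𝕜) (ResField V 𝕜) :=
  mem_annihilator_resField.mpr (Ideal.subset_span ⟨v, rfl⟩)

/-- The variables in W form a regular sequence: dividing out one of them deletes that vertex from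
the simplex. -/
lemma extVanish_simplex [Finite V] (W : Set V) :
    ExtVanish (R := MvPolynomial V 𝕜) (ResField V 𝕜) W.ncard (faceRing 𝕜 (simplex W)) := by
  induction W, W.toFinite using Set.Finite.induction_on with
  | empty => intro i hi; simp at hi
  | @insert v W hv hW ih =>
    rw [Set.ncard_insert_of_notMem hv hW]
    refine ExtVanish.succ_of_isSMulRegular (X_mem_annihilator_resField 𝕜 v)
      (isSMulRegular_X_faceRing_simplex 𝕜 (Set.mem_insert v W)) ?_
    replace ih := ExtVanish.subquot_top.mpr ih
    rw [faceIdeal_simplex_of_insert 𝕜 hv] at ih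
    have e := quotSMulTopSubquotEquiv (faceIdeal 𝕜 (simplex (insert v W))) ⊤
      (X v : MvPolynomial V 𝕜)
    have e' : Subquot (faceIdeal 𝕜 (simplex (insert v W))) ⊤ ≃ₗ[MvPolynomial V 𝕜]
        faceRing 𝕜 (simplex (insert v W)) :=
      Submodule.Quotient.equiv _ _ Submodule.topEquiv (by ext x; simp [Submodule.submoduleOf])
    exact (ih.of_equiv e.symm).of_equiv (QuotSMulTop.congr _ e')

/-- Killing the variables outside σ maps the face ring onto a polynomial ring in |σ| variables. -/
lemma natCast_card_le_supportDim [Finite V] {Δ : Complex V} {σ : Finset V} (hσ : σ ∈ Δ) :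
    ((σ.card : ℕ∞) : WithBot ℕ∞) ≤
      Module.supportDim (MvPolynomial V 𝕜) (faceRing 𝕜 Δ) := by
  classical
  rw [Module.supportDim_quotient_eq_ringKrullDim]
  let φ : MvPolynomial V 𝕜 →ₐ[𝕜] MvPolynomial σ 𝕜 :=
    aeval fun v => if h : v ∈ σ then X ⟨v, h⟩ else 0
  have hφ : ∀ f ∈ faceIdeal 𝕜 Δ, φ f = 0 := by
    suffices faceIdeal 𝕜 Δ ≤ RingHom.ker φ.toRingHom from fun f hf => this hf
    refine Ideal.span_le.mpr ?_
    rintro _ ⟨τ, hτ, rfl⟩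
    obtain ⟨v, hv, hvσ⟩ : ∃ v ∈ τ, v ∉ σ := by
      by_contra! hcon
      exact hτ (Δ.lower hcon hσ)
    change φ _ = 0
    rw [map_prod]
    exact Finset.prod_eq_zero hv (by simp [φ, hvσ])
  have hsurj : Function.Surjective φ := by
    intro g
    refine ⟨rename Subtype.val g, ?_⟩
    rw [aeval_rename]
    have : ((fun v => if h : v ∈ σ then (X ⟨v, h⟩ : MvPolynomial σ 𝕜) else 0) ∘ Subtype.val) =
        X := by
      funext v
      simp
    rw [this, aeval_X_left_apply]
  have h1 := ringKrullDim_le_of_surjective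
    (Ideal.Quotient.lift (faceIdeal 𝕜 Δ) φ.toRingHom hφ)
    (Ideal.Quotient.lift_surjective_of_surjective _ hφ hsurj)
  have h2 := ringKrullDim_add_natCard_le_ringKrullDim_mvPolynomial (R := 𝕜) σ
  rw [ringKrullDim_eq_zero_of_field, zero_add, Nat.card_eq_fintype_card, Fintype.card_coe] at h2
  exact h2.trans h1

/-- A nonzero constant is a unit, and a unit in the sequence would contradict M ≠ ΘM. -/
lemma mem_idealOfVars_of_isHomogeneous {M : Type*} [AddCommGroup M] [Module (MvPolynomial V 𝕜) M]
    {Θ : List (MvPolynomial V 𝕜)} (hΘ : RingTheory.Sequence.IsRegular M Θ)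
    {θ : MvPolynomial V 𝕜} (hθ : θ ∈ Θ) {e : ℕ} (he : θ.IsHomogeneous e) :
    θ ∈ idealOfVars V 𝕜 := by
  rcases e with _ | e
  · rw [← totalDegree_zero_iff_isHomogeneous, totalDegree_eq_zero_iff_eq_C] at he
    by_cases hc : θ.coeff 0 = 0
    · rw [he, hc, C_0]
      exact zero_mem _
    · refine absurd ?_ hΘ.top_ne_smul
      have hunit : IsUnit θ := by
        rw [he]
        exact (IsUnit.mk0 _ hc).map C
      rw [(Ideal.ofList Θ).eq_top_of_isUnit_mem (Ideal.subset_span hθ) hunit,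
        Submodule.top_smul]
  · rw [idealOfVars, ← Set.image_univ, mem_ideal_span_X_image]
    intro m hm
    by_contra! hcon
    have hm0 : m = 0 := by
      ext v
      exact hcon v trivial
    have := degree_eq_of_isHomogeneous he hm
    rw [hm0] at this
    simp at this

lemma IsCM.extVanish [Finite V] {Δ : Complex V} (hΔ : IsCM 𝕜 Δ) {σ : Finset V} (hσ : σ ∈ Δ) :
    ExtVanish (R := MvPolynomial V 𝕜) (ResField V 𝕜) σ.card (faceRing 𝕜 Δ) := by
  rcases Nat.eq_zero_or_pos σ.card with h0 | hpos
  · intro i hi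
    omega
  have hle := natCast_card_le_supportDim 𝕜 hσ
  rw [← (show depth 𝕜 V (faceRing 𝕜 Δ) = _ from hΔ)] at hle
  by_contra hcon
  -- Were every homogeneous regular sequence shorter than |σ|, the supremum would be at most |σ| -
  -- 1. The case |σ| = 0 is set aside because of the truncated subtraction.
  have hlt : depth 𝕜 V (faceRing 𝕜 Δ) ≤ (((σ.card - 1 : ℕ) : ℕ∞) : WithBot ℕ∞) := by
    refine iSup_le fun ⟨Θ, hΘ, hreg⟩ => ?_
    by_contra hlen
    have hlen' : σ.card ≤ Θ.length := by
      by_contra h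
      refine hlen ?_
      have hlt : Θ.length ≤ σ.card - 1 := by omega
      exact_mod_cast hlt
    refine hcon ((ExtVanish.of_isWeaklyRegular Θ (fun θ hθ => ?_) hreg.toIsWeaklyRegular).mono
      hlen')
    obtain ⟨e, he⟩ := hΘ θ hθ
    exact mem_annihilator_resField.mpr (mem_idealOfVars_of_isHomogeneous 𝕜 hreg hθ he)
  have := hle.trans hlt
  norm_cast at this
  omega

/-- The depth of the Stanley–Reisner ideal of a Cohen–Macaulay complex exceeds that of its face
ring by one. -/
lemma IsCM.extVanish_subquot [Finite V] {Δ : Complex V} (hΔ : IsCM 𝕜 Δ) {σ : Finset V}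
    (hσ : σ ∈ Δ) :
    ExtVanish (R := MvPolynomial V 𝕜) (ResField V 𝕜) (σ.card + 1)
      (Subquot (faceIdeal 𝕜 (simplex (vertices Δ))) (faceIdeal 𝕜 Δ)) := by
  have hsub : (σ : Set V) ⊆ vertices Δ := le_simplex_vertices Δ hσ
  rcases lt_or_ge σ.card (vertices Δ).ncard with h | h
  · refine ExtVanish.subquot_left (faceIdeal_antitone 𝕜 (le_simplex_vertices Δ)) le_top
      (C := ⊤) ?_ ?_
    · exact ExtVanish.subquot_top.mpr ((extVanish_simplex 𝕜 _).mono h)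
    · exact ExtVanish.subquot_top.mpr (hΔ.extVanish 𝕜 hσ)
  -- Here σ uses all vertices, so Δ is a simplex and the subquotient is zero.
  · have heq : (σ : Set V) = vertices Δ :=
      Set.eq_of_subset_of_ncard_le hsub (by rwa [Set.ncard_coe_finset])
    have : simplex (vertices Δ) = Δ := by
      refine le_antisymm (fun τ hτ => Δ.lower (fun v hv => ?_) hσ) (le_simplex_vertices Δ)
      have := hτ v hv
      rwa [← heq] at this
    rw [this]
    exact ExtVanish.subquot_self _ _

/-- Gluing F i onto D' = Δ ∪ ⋃_{j ∈ s} F j: the cokernel I_{D'} / I_{D' ∪ F i} is I_{D' ∩ F i} /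
I_{F i} = I_{Γ i} / I_{F i}, so depth d there suffices to keep depth d + 1. -/
lemma extVanish_sup {ι : Type*} {T Δ : Complex V} {F Γ : ι → Complex V} {d : ℕ}
    (hΔT : Δ ≤ T) (hFT : ∀ i, F i ≤ T) (hΔF : ∀ i, Δ ⊓ F i = Γ i)
    (hF : ∀ i j, i ≠ j → F i ⊓ F j ≤ Γ j)
    (hΔ : ExtVanish (R := MvPolynomial V 𝕜) (ResField V 𝕜) (d + 1)
      (Subquot (faceIdeal 𝕜 T) (faceIdeal 𝕜 Δ)))
    (hΓ : ∀ i, ExtVanish (R := MvPolynomial V 𝕜) (ResField V 𝕜) d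
      (Subquot (faceIdeal 𝕜 (F i)) (faceIdeal 𝕜 (Γ i)))) (s : Finset ι) :
    ExtVanish (R := MvPolynomial V 𝕜) (ResField V 𝕜) (d + 1)
      (Subquot (faceIdeal 𝕜 T) (faceIdeal 𝕜 (Δ ⊔ s.sup F))) := by
  classical
  induction s using Finset.induction_on with
  | empty => rwa [Finset.sup_empty, sup_bot_eq]
  | insert i s hi ih =>
    have hinf : (Δ ⊔ s.sup F) ⊓ F i = Γ i := by
      rw [inf_sup_right, hΔF, sup_eq_left, Finset.sup_inf_distrib_right]
      exact Finset.sup_le fun j hj => hF j i fun h => hi (h ▸ hj)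
    have heq : Δ ⊔ (insert i s).sup F = (Δ ⊔ s.sup F) ⊔ F i := by
      rw [Finset.sup_insert, sup_comm (F i), sup_assoc]
    rw [heq]
    refine ExtVanish.subquot_left (faceIdeal_antitone 𝕜 ?_) (faceIdeal_antitone 𝕜 le_sup_left)
      ih ?_
    · exact sup_le (sup_le hΔT (Finset.sup_le fun j _ => hFT j)) (hFT i)
    · rw [faceIdeal_sup]
      refine ExtVanish.subquot_sup ?_
      rw [← faceIdeal_inf, hinf]
      exact hΓ i

end StanleyReisner

/-! ### Power series weights and binomial coefficients. -/

section Weights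

open PowerSeries

/-- The power series `(1 - X)^(-a)`, for an integer `a`. -/
noncomputable def multichooseSeries (a : ℤ) : PowerSeries ℤ :=
  PowerSeries.mk fun k => Ring.multichoose a k

lemma one_sub_X_mul_multichooseSeries (a : ℤ) :
    (1 - X) * multichooseSeries (a + 1) = multichooseSeries a := by
  ext k
  rw [sub_mul, one_mul, map_sub]
  rcases k with _ | k
  · simp [multichooseSeries]
  · simp [multichooseSeries, PowerSeries.coeff_succ_X_mul, Ring.multichoose_succ_succ]

lemma multichooseSeries_zero : multichooseSeries 0 = 1 := by
  ext k
  rcases k with _ | k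
  · simp [multichooseSeries]
  · simp [multichooseSeries, PowerSeries.coeff_one, Ring.multichoose_zero_succ]

lemma one_sub_X_mul_multichooseSeries_one : (1 - X) * multichooseSeries 1 = 1 := by
  have := one_sub_X_mul_multichooseSeries 0
  rwa [zero_add, multichooseSeries_zero] at this

lemma multichooseSeries_natCast (n : ℕ) :
    multichooseSeries n = multichooseSeries 1 ^ n := by
  induction n with
  | zero => simp [multichooseSeries_zero]
  | succ n ih =>
    rw [pow_succ, ← ih, ← one_sub_X_mul_multichooseSeries (n : ℤ)]
    push_cast
    rw [mul_right_comm, one_sub_X_mul_multichooseSeries_one, one_mul]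

lemma multichooseSeries_sub_natCast (a : ℤ) (d : ℕ) :
    multichooseSeries (a - d) = (1 - X) ^ d * multichooseSeries a := by
  induction d with
  | zero => simp
  | succ d ih =>
    rw [pow_succ', mul_assoc, ← ih, ← one_sub_X_mul_multichooseSeries]
    congr 2
    push_cast
    ring

/-- The weight `X^n (1 - X)^(d - n)` of a set with `n` elements. -/
noncomputable def weight (d n : ℕ) : PowerSeries ℤ :=
  -- The power series form also makes sense for n > d, which is needed because faces of (T, D) may
  -- have more than d elements.
  (1 - X) ^ d * (X * multichooseSeries 1) ^ n

lemma weight_of_le {d n : ℕ} (h : n ≤ d) : weight d n = X ^ n * (1 - X) ^ (d - n) := by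
  obtain ⟨e, rfl⟩ := Nat.exists_eq_add_of_le h
  rw [weight, Nat.add_sub_cancel_left, pow_add, mul_pow]
  calc _ = X ^ n * (1 - X) ^ e * ((1 - X) ^ n * multichooseSeries 1 ^ n) := by ring
    _ = _ := by rw [← mul_pow, one_sub_X_mul_multichooseSeries_one, one_pow, mul_one]

lemma coeff_weight_of_lt (d : ℕ) {n j : ℕ} (h : j < n) : coeff j (weight d n) = 0 := by
  rw [weight, mul_pow, mul_left_comm, coeff_X_pow_mul', if_neg (by omega)]

lemma coeff_weight_self (d n : ℕ) : coeff n (weight d n) = 1 := by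
  rw [weight, mul_pow, mul_left_comm, coeff_X_pow_mul', if_pos le_rfl, Nat.sub_self]
  simp [multichooseSeries]

lemma weight_zero (d : ℕ) : weight d 0 = multichooseSeries (-d : ℤ) := by
  rw [weight, ← zero_sub, multichooseSeries_sub_natCast, multichooseSeries_zero, pow_zero]

/-- By the binomial theorem the sum is (1 - X)^d (X/(1 - X) + 1)^|W|, and the last base is 1/(1 -
X). -/
lemma sum_powerset_weight {V : Type*} (d : ℕ) (W : Finset V) :
    ∑ σ ∈ W.powerset, weight d σ.card = multichooseSeries (W.card - d) := by
  have h1 : X * multichooseSeries 1 + 1 = multichooseSeries 1 := by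
    linear_combination -one_sub_X_mul_multichooseSeries_one
  have h := Finset.sum_pow_mul_eq_add_pow (X * multichooseSeries 1) 1 W
  simp only [one_pow, mul_one, h1] at h
  simp only [weight]
  rw [← Finset.mul_sum, h, multichooseSeries_sub_natCast, multichooseSeries_natCast]

lemma coeff_X_mul_multichooseSeries_one (n : ℕ) :
    coeff n (X * multichooseSeries 1) = if n ≠ 0 then 1 else 0 := by
  rcases n with _ | n
  · simp
  · simp [PowerSeries.coeff_succ_X_mul, multichooseSeries, Ring.multichoose_one]

lemma coeff_monotone_of_one_sub_X_mul {P : PowerSeries ℤ}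
    (h : ∀ j, 0 ≤ coeff j ((1 - X) * P)) : Monotone fun j => coeff j P := by
  refine monotone_nat_of_le_succ fun j => ?_
  have := h (j + 1)
  rw [sub_mul, one_mul, map_sub, PowerSeries.coeff_succ_X_mul] at this
  linarith

lemma coeff_nonneg_of_one_sub_X_mul {P : PowerSeries ℤ}
    (h : ∀ j, 0 ≤ coeff j ((1 - X) * P)) (j : ℕ) : 0 ≤ coeff j P := by
  refine le_trans ?_ (coeff_monotone_of_one_sub_X_mul h (Nat.zero_le j))
  simpa [sub_mul] using h 0

/-- Each factor X/(1 - X) supplies a positive exponent at one element of σ. -/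
lemma coeff_pow_card_eq {V : Type*} [Fintype V] [DecidableEq V] (σ : Finset V) (j : ℕ) :
    coeff j ((X * multichooseSeries 1) ^ σ.card : PowerSeries ℤ) =
      (((Finset.univ.finsuppAntidiag j).filter fun m : V →₀ ℕ => m.support = σ).card : ℤ) := by
  rw [← Finset.prod_const, PowerSeries.coeff_prod]
  simp only [coeff_X_mul_multichooseSeries_one]
  rw [Finset.card_filter, Nat.cast_sum]
  have hsub : σ.finsuppAntidiag j ⊆ (Finset.univ : Finset V).finsuppAntidiag j :=
    Finset.finsuppAntidiag_mono (Finset.subset_univ σ) j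
  rw [← Finset.sum_subset hsub]
  · refine Finset.sum_congr rfl fun m hm => ?_
    have hm' := (Finset.mem_finsuppAntidiag.mp hm).2
    by_cases h : m.support = σ
    · rw [if_pos h, Finset.prod_eq_one]
      · simp
      · intro i hi
        rw [if_pos]
        rw [← h] at hi
        exact Finsupp.mem_support_iff.mp hi
    · obtain ⟨v, hv, hvm⟩ : ∃ v ∈ σ, v ∉ m.support := by
        by_contra! hcon
        exact h (le_antisymm hm' hcon)
      rw [if_neg h, Finset.prod_eq_zero hv]
      · simp
      · simpa using hvm
  · intro m hm hmσ
    rw [if_neg, Nat.cast_zero]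
    rintro rfl
    refine hmσ (Finset.mem_finsuppAntidiag.mpr ⟨?_, subset_rfl⟩)
    rw [← (Finset.mem_finsuppAntidiag.mp hm).1]
    exact Finset.sum_subset (Finset.subset_univ _) fun v _ hv => by simpa using hv

end Weights

/-- A facet of Δ of maximal size is too large to lie in G, so the relative h-vector is normalized by
d. -/
lemma rank_eq {V : Type*} {Δ G : Complex V} {d : ℕ} (hΔ : HasDim Δ ((d : ℤ) - 1))
    (hG : ∀ σ ∈ G, σ.card < d) : rank Δ G = d := by
  obtain ⟨⟨σ, hσ, hσd⟩, hmax⟩ := hΔ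
  refine IsGreatest.csSup_eq ⟨⟨σ, ⟨hσ, fun h => ?_⟩, by omega⟩, ?_⟩
  · have := hG σ h
    omega
  · rintro _ ⟨τ, hτ, rfl⟩
    have := hmax ⟨τ, hτ.1, rfl⟩
    omega

/-! ### Weighted face counts. -/

section Counting

universe u v

open PowerSeries

variable {V : Type u} [Fintype V]

open Classical in
/-- The relative faces as a finite set. -/
noncomputable def relFinset (Δ Γ : Complex V) : Finset (Finset V) :=
  Finset.univ.filter fun σ => σ ∈ Δ ∧ σ ∉ Γ

lemma mem_relFinset {Δ Γ : Complex V} {σ : Finset V} : σ ∈ relFinset Δ Γ ↔ σ ∈ Δ ∧ σ ∉ Γ := by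
  simp [relFinset]

lemma hilbertDiff_faceIdeal (𝕜 : Type v) [Field 𝕜] {T D : Complex V} (h : D ≤ T) :
    hilbertDiff (faceIdeal 𝕜 T) (faceIdeal 𝕜 D) =
      ∑ σ ∈ relFinset T D, (X * multichooseSeries 1) ^ σ.card := by
  classical
  have hcard : ∀ (Δ : Complex V) (j : ℕ), {m : V →₀ ℕ | m.degree = j ∧ m.support ∉ Δ}.ncard =
      ((Finset.univ.finsuppAntidiag j).filter fun m : V →₀ ℕ => m.support ∉ Δ).card := by
    intro Δ j
    rw [← Set.ncard_coe_finset]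
    congr 1
    ext m
    simp [Finset.mem_finsuppAntidiag, Finsupp.degree_eq_sum]
  ext j
  simp only [hilbertDiff, PowerSeries.coeff_mk, finrank_gradedPiece_faceIdeal, hcard, map_sum,
    coeff_pow_card_eq, Finset.card_filter]
  push_cast
  rw [Finset.sum_comm, ← Finset.sum_sub_distrib]
  refine Finset.sum_congr rfl fun m _ => ?_
  rw [Finset.sum_ite_eq]
  by_cases h1 : m.support ∈ D
  · have h2 : m.support ∈ T := h h1
    simp [h1, h2, mem_relFinset]
  · by_cases h2 : m.support ∈ T <;> simp [h1, h2, mem_relFinset]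

lemma hNum_eq {Δ Γ : Complex V} {d : ℕ} (hd : rank Δ Γ = d) (k : ℕ) :
    hNum Δ Γ k = coeff k (∑ σ ∈ relFinset Δ Γ, weight d σ.card) := by
  classical
  have hle : ∀ σ ∈ relFinset Δ Γ, σ.card ∈ Finset.range (d + 1) := by
    intro σ hσ
    rw [Finset.mem_range, Nat.lt_succ_iff, ← hd]
    refine le_csSup ⟨Fintype.card V, ?_⟩ ⟨σ, mem_relFinset.mp hσ, rfl⟩
    rintro _ ⟨τ, -, rfl⟩
    exact Finset.card_le_univ τ
  have hnum : ∀ j, numFaces Δ Γ j = ((relFinset Δ Γ).filter fun σ => σ.card = j).card := by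
    intro j
    rw [numFaces, ← Set.ncard_coe_finset]
    congr 1
    ext σ
    simp [mem_relFinset, relFaces]
  rw [hNum, ← Polynomial.coeff_coe, hPoly, ← Finset.sum_fiberwise_of_maps_to hle, hd]
  congr 1
  rw [← Polynomial.coeToPowerSeries.ringHom_apply, map_sum]
  refine Finset.sum_congr rfl fun j hj => ?_
  rw [Finset.sum_congr rfl (g := fun _ => weight d j)
    (fun σ hσ => by rw [(Finset.mem_filter.mp hσ).2]), Finset.sum_const,
    weight_of_le (by simpa [Nat.lt_succ_iff] using hj), hnum]
  simp only [map_mul, map_natCast, map_pow, map_sub, map_one,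
    Polynomial.coeToPowerSeries.ringHom_apply, Polynomial.coe_X, nsmul_eq_mul, mul_assoc]

lemma sum_relFinset_simplex (d : ℕ) (W : Set V) :
    ∑ σ ∈ relFinset (simplex W) ⊥, weight d σ.card = multichooseSeries (W.ncard - d) := by
  classical
  rw [Set.ncard_eq_toFinset_card', ← sum_powerset_weight]
  refine Finset.sum_congr ?_ fun _ _ => rfl
  ext σ
  simp [mem_relFinset, mem_simplex, Finset.subset_iff]

/-- Nonempty faces of T split disjointly among (Δ, G), (T, D) and the F i. Only the empty face is
overcounted, once for each F i, whence the correction by m - 1. -/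
lemma sum_weight_eq {m : ℕ} {T Δ G : Complex V} {F : Fin m → Complex V} (hΔT : Δ ≤ T)
    (hFT : ∀ i, F i ≤ T) (hempty : ∀ i, ∅ ∈ F i) (hm : 1 ≤ m)
    (hF : ∀ i j, i ≠ j → ∀ σ, σ ∈ F i → σ ∈ F j → σ = ∅)
    (hG : ∀ σ ∈ Δ, σ ∈ G ↔ ∃ i, σ ∈ F i) {A : Type*} [CommRing A] (w : Finset V → A) :
    ∑ σ ∈ relFinset T ⊥, w σ =
      ∑ σ ∈ relFinset Δ G, w σ + ∑ σ ∈ relFinset T (Δ ⊔ Finset.univ.sup F), w σ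
        + ∑ i, ∑ σ ∈ relFinset (F i) ⊥, w σ - ((m : A) - 1) * w ∅ := by
  classical
  have hsup : ∀ σ, σ ∈ Finset.univ.sup F ↔ ∃ i, σ ∈ F i := by
    intro σ
    rw [Finset.sup_univ_eq_iSup, LowerSet.mem_iSup_iff]
  have key : ∀ σ : Finset V, (if σ ∈ T then w σ else 0) =
      (if σ ∈ Δ ∧ σ ∉ G then w σ else 0) + (if σ ∈ T ∧ σ ∉ Δ ⊔ Finset.univ.sup F then w σ else 0)
        + (∑ i, if σ ∈ F i then w σ else 0) - (if σ = ∅ then ((m : A) - 1) * w σ else 0) := by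
    intro σ
    rw [LowerSet.mem_sup_iff, hsup]
    by_cases h0 : σ = ∅
    · subst h0
      have h1 : ∃ i, ∅ ∈ F i := ⟨⟨0, hm⟩, hempty _⟩
      have hT : ∅ ∈ T := hFT _ h1.choose_spec
      have h2 : ¬ ((∅ : Finset V) ∈ Δ ∧ ∅ ∉ G) := fun h => h.2 ((hG _ h.1).mpr h1)
      rw [if_pos hT, if_neg h2, if_neg (fun h => h.2 (Or.inr h1)), if_pos rfl,
        Finset.sum_congr rfl (fun i _ => if_pos (hempty i))]
      simp
      ring
    · rw [if_neg h0, sub_zero]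
      by_cases h1 : ∃ i, σ ∈ F i
      · obtain ⟨i, hi⟩ := h1
        have hsum : (∑ i, if σ ∈ F i then w σ else 0) = w σ := by
          rw [Finset.sum_eq_single i, if_pos hi]
          · intro j _ hj
            exact if_neg fun h => h0 (hF j i hj σ h hi)
          · intro h
            exact absurd (Finset.mem_univ i) h
        have hT : σ ∈ T := hFT i hi
        rw [hsum, if_pos hT, if_neg (fun h => h.2 ((hG _ h.1).mpr ⟨i, hi⟩)),
          if_neg (fun h => h.2 (Or.inr ⟨i, hi⟩)), zero_add, zero_add]
      · have hsum : (∑ i, if σ ∈ F i then w σ else 0) = 0 :=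
          Finset.sum_eq_zero fun i _ => if_neg fun h => h1 ⟨i, h⟩
        rw [hsum, add_zero]
        by_cases hσ : σ ∈ Δ
        · have hσG : σ ∉ G := fun h => h1 ((hG σ hσ).mp h)
          have hT : σ ∈ T := hΔT hσ
          simp [hσ, hσG, hT]
        · simp [hσ, h1]
  have hfil : ∀ Δ' Γ' : Complex V, ∑ σ ∈ relFinset Δ' Γ', w σ =
      ∑ σ, if σ ∈ Δ' ∧ σ ∉ Γ' then w σ else 0 := by
    intro Δ' Γ'
    rw [← Finset.sum_filter]
    refine Finset.sum_congr ?_ fun _ _ => rfl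
    ext σ
    simp [mem_relFinset]
  simp only [hfil, LowerSet.notMem_bot, not_false_eq_true, and_true]
  rw [Finset.sum_congr rfl fun σ _ => key σ, Finset.sum_sub_distrib, Finset.sum_add_distrib,
    Finset.sum_add_distrib, Finset.sum_comm (s := Finset.univ) (t := Finset.univ)
    (f := fun (σ : Finset V) (i : Fin m) => if σ ∈ F i then w σ else 0)]
  simp

lemma sum_weight_coeff_pos {d j : ℕ} {T D : Complex V} {σ : Finset V} (hσ : σ ∈ relFinset T D)
    (hσj : σ.card = j) (hmin : ∀ τ ∈ relFinset T D, j ≤ τ.card) :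
    0 < coeff j (∑ τ ∈ relFinset T D, weight d τ.card) := by
  rw [map_sum]
  refine Finset.sum_pos' (fun τ hτ => ?_) ⟨σ, hσ, by rw [hσj, coeff_weight_self]; exact one_pos⟩
  rcases (hmin τ hτ).lt_or_eq with h | h
  · rw [coeff_weight_of_lt d h]
  · rw [← h, coeff_weight_self]
    exact zero_le_one

/-- The lowest nonzero coefficient counts the faces of minimal size, and monotonicity keeps all
later coefficients positive. -/
lemma sum_weight_coeff_eq_zero_iff {d k : ℕ} {T D : Complex V}
    (h : ∀ j, 0 ≤ coeff j ((1 - X) * ∑ σ ∈ relFinset T D, weight d σ.card)) :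
    coeff k (∑ σ ∈ relFinset T D, weight d σ.card) = 0 ↔ ∀ σ ∈ relFinset T D, k < σ.card := by
  constructor
  · intro h0 σ hσ
    by_contra! hk
    obtain ⟨τ, hτ, hmin⟩ := (relFinset T D).exists_min_image Finset.card ⟨σ, hσ⟩
    have hpos := sum_weight_coeff_pos (d := d) hτ rfl hmin
    have := coeff_monotone_of_one_sub_X_mul h ((hmin σ hσ).trans hk)
    simp only at this
    omega
  · intro hσ
    rw [map_sum]
    exact Finset.sum_eq_zero fun σ h => coeff_weight_of_lt d (hσ σ h)

end Counting

/-! ### Disjoint full arrangements of codimension one. -/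

section Arrangements

universe u v

variable {V : Type u} {m d : ℕ} {Δ : Complex V} {Γ : Fin m → Complex V}

lemma simplex_vertices_inter_eq_empty (hdisj : ∀ i j, i ≠ j → AreDisjoint (Γ i) (Γ j))
    {i j : Fin m} (hij : i ≠ j) {σ : Finset V} (hi : σ ∈ simplex (vertices (Γ i)))
    (hj : σ ∈ simplex (vertices (Γ j))) : σ = ∅ := by
  refine Finset.eq_empty_of_forall_notMem fun v hv => ?_
  exact Finset.singleton_ne_empty v (hdisj i j hij {v} (hi v hv) (hj v hv))

lemma mem_iSup_iff_of_isFullArrangement (hfull : IsFullArrangement Δ Γ) {σ : Finset V}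
    (hσ : σ ∈ Δ) : σ ∈ ⨆ i, Γ i ↔ ∃ i, σ ∈ simplex (vertices (Γ i)) := by
  rw [LowerSet.mem_iSup_iff]
  exact exists_congr fun i => ⟨fun h => le_simplex_vertices (Γ i) h, (hfull i).2 σ hσ⟩

lemma HasDim.empty_mem {e : ℤ} {Δ : Complex V} (h : HasDim Δ e) : ∅ ∈ Δ := by
  obtain ⟨σ, hσ, -⟩ := h.1
  exact Δ.lower (Finset.empty_subset σ) hσ

/-- The relative face module of the simplex on the vertices of `Δ` modulo `Δ` and the simplices on
the members of a disjoint full Cohen–Macaulay arrangement of codimension one has depth at least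
`dim Δ + 2`. -/
lemma extVanish_arrangement {𝕜 : Type v} [Field 𝕜] [Finite V]
    (hΔ : IsCM 𝕜 Δ) (hdimΔ : HasDim Δ ((d : ℤ) - 1)) (hfull : IsFullArrangement Δ Γ)
    (hdisj : ∀ i j, i ≠ j → AreDisjoint (Γ i) (Γ j)) (hdimΓ : ∀ i, HasDim (Γ i) ((d : ℤ) - 2))
    (hΓ : ∀ i, IsCM 𝕜 (Γ i)) :
    ExtVanish (R := MvPolynomial V 𝕜) (ResField V 𝕜) (d + 1)
      (Subquot (faceIdeal 𝕜 (simplex (vertices Δ)))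
        (faceIdeal 𝕜 (Δ ⊔ Finset.univ.sup fun i => simplex (vertices (Γ i))))) := by
  refine extVanish_sup 𝕜 (Γ := Γ) (le_simplex_vertices Δ) (fun i σ hσ v hv => ?_) (fun i => ?_)
    (fun i j hij σ hσ => ?_) ?_ (fun i => ?_) _
  · exact (hfull i).1 (hσ v hv)
  · refine le_antisymm (fun σ hσ => (hfull i).2 σ hσ.1 hσ.2) ?_
    exact le_inf (hfull i).1 (le_simplex_vertices _)
  -- Distinct simplices share only the empty face, which lies in Γ j because Γ j is not void.
  · have : σ = ∅ := simplex_vertices_inter_eq_empty hdisj hij hσ.1 hσ.2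
    rw [this]
    exact (hdimΓ j).empty_mem
  · obtain ⟨σ, hσ, hσd⟩ := hdimΔ.1
    have : σ.card = d := by omega
    rw [← this]
    exact hΔ.extVanish_subquot 𝕜 hσ
  · obtain ⟨σ, hσ, hσd⟩ := (hdimΓ i).1
    have : σ.card + 1 = d := by omega
    rw [← this]
    exact (hΓ i).extVanish_subquot 𝕜 hσ

-- The binomials are the total weights of the simplices T, F i and of the empty face, as
-- `Ring.multichoose a k` is the binomial coefficient of a + k - 1 over k.
open PowerSeries in
lemma choose_sub_hNum_eq_coeff [Fintype V] (hm : 1 ≤ m)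
    (hdimΔ : HasDim Δ ((d : ℤ) - 1)) (hfull : IsFullArrangement Δ Γ)
    (hdisj : ∀ i j, i ≠ j → AreDisjoint (Γ i) (Γ j)) (hdimΓ : ∀ i, HasDim (Γ i) ((d : ℤ) - 2))
    (k : ℕ) :
    (Ring.choose (((vertices Δ).ncard : ℤ) - d + k - 1) k
      - ∑ i, Ring.choose (((vertices (Γ i)).ncard : ℤ) - d + k - 1) k
      + ((m : ℤ) - 1) * Ring.choose (-(d : ℤ) + k - 1) k) - hNum Δ (⨆ i, Γ i) k =
    coeff k (∑ σ ∈ relFinset (simplex (vertices Δ))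
      (Δ ⊔ Finset.univ.sup fun i => simplex (vertices (Γ i))), weight d σ.card) := by
  have hrank : rank Δ (⨆ i, Γ i) = d := by
    refine rank_eq hdimΔ fun σ hσ => ?_
    obtain ⟨i, hi⟩ := LowerSet.mem_iSup_iff.mp hσ
    have := (hdimΓ i).2 ⟨σ, hi, rfl⟩
    omega
  have h := sum_weight_eq (T := simplex (vertices Δ)) (G := ⨆ i, Γ i)
    (F := fun i => simplex (vertices (Γ i))) (le_simplex_vertices Δ)
    (fun i σ hσ v hv => (hfull i).1 (hσ v hv)) (fun i v hv => absurd hv (Finset.notMem_empty v)) hm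
    (fun i j hij σ hi hj => simplex_vertices_inter_eq_empty hdisj hij hi hj)
    (fun σ hσ => mem_iSup_iff_of_isFullArrangement hfull hσ) (fun σ => weight d σ.card)
  simp only [sum_relFinset_simplex, Finset.card_empty, weight_zero] at h
  have hk := congrArg (coeff k) h
  have hcast : (m : PowerSeries ℤ) - 1 = C ((m : ℤ) - 1) := by simp
  rw [hcast, map_sub, map_add, map_add, ← hNum_eq hrank, map_sum (coeff k) (fun i : Fin m => _),
    PowerSeries.coeff_C_mul] at hk
  simp only [multichooseSeries, PowerSeries.coeff_mk, Ring.multichoose_eq] at hk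
  linarith

open PowerSeries in
lemma coeff_one_sub_X_mul_sum_weight_nonneg (𝕜 : Type v) [Field 𝕜] [Infinite 𝕜] [Fintype V]
    {T D : Complex V} (h : D ≤ T)
    (hT : ExtVanish (R := MvPolynomial V 𝕜) (ResField V 𝕜) (d + 1)
      (Subquot (faceIdeal 𝕜 T) (faceIdeal 𝕜 D))) (j : ℕ) :
    0 ≤ coeff j ((1 - X) * ∑ σ ∈ relFinset T D, weight d σ.card) := by
  have := coeff_hilbertDiff_nonneg (d + 1) (faceIdeal_antitone 𝕜 h) (isHomog_faceIdeal 𝕜 T)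
    (isHomog_faceIdeal 𝕜 D) hT j
  rwa [hilbertDiff_faceIdeal 𝕜 h, pow_succ', mul_assoc, Finset.mul_sum] at this

end Arrangements

end RelSR

/-! ### The inequality and its equality case. -/

theorem mainTheorem9 {𝕜 : Type*} [Field 𝕜] [Infinite 𝕜] {V : Type*} [Finite V]
    (d m : ℕ) (hm : 1 ≤ m)
    (Δ : RelSR.Complex V) (hΔ : RelSR.IsCM 𝕜 Δ) (hdimΔ : RelSR.HasDim Δ ((d : ℤ) - 1))
    (Γ : Fin m → RelSR.Complex V) (hfull : RelSR.IsFullArrangement Δ Γ)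
    (hdisj : ∀ i j, i ≠ j → RelSR.AreDisjoint (Γ i) (Γ j))
    (hdimΓ : ∀ i, RelSR.HasDim (Γ i) ((d : ℤ) - 2))
    (hΓ : ∀ i, RelSR.IsCM 𝕜 (Γ i)) :
    (∀ k : ℕ, k ≤ d →
      RelSR.hNum Δ (⨆ i, Γ i) k ≤
        Ring.choose (((RelSR.vertices Δ).ncard : ℤ) - d + k - 1) k
          - ∑ i, Ring.choose (((RelSR.vertices (Γ i)).ncard : ℤ) - d + k - 1) k
          + ((m : ℤ) - 1) * Ring.choose (-(d : ℤ) + k - 1) k) ∧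
    (∀ k₀ : ℕ, k₀ ≤ d →
      (RelSR.hNum Δ (⨆ i, Γ i) k₀ =
          Ring.choose (((RelSR.vertices Δ).ncard : ℤ) - d + k₀ - 1) k₀
            - ∑ i, Ring.choose (((RelSR.vertices (Γ i)).ncard : ℤ) - d + k₀ - 1) k₀
            + ((m : ℤ) - 1) * Ring.choose (-(d : ℤ) + k₀ - 1) k₀ ↔
        ∀ σ : Finset V, RelSR.IsNonFace Δ σ → (σ.card : ℤ) - 1 < k₀ →
          ∃ i, ∀ v ∈ σ, v ∈ RelSR.vertices (Γ i))) := by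
  have := Fintype.ofFinite V
  have hdiff := RelSR.choose_sub_hNum_eq_coeff hm hdimΔ hfull hdisj hdimΓ
  have hDT : Δ ⊔ (Finset.univ.sup fun i => RelSR.simplex (RelSR.vertices (Γ i))) ≤
      RelSR.simplex (RelSR.vertices Δ) :=
    sup_le (RelSR.le_simplex_vertices Δ)
      (Finset.sup_le fun i _ σ hσ v hv => (hfull i).1 (hσ v hv))
  have hnonneg := RelSR.coeff_one_sub_X_mul_sum_weight_nonneg 𝕜 hDT
    (RelSR.extVanish_arrangement hΔ hdimΔ hfull hdisj hdimΓ hΓ)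
  refine ⟨fun k _ => ?_, fun k _ => ?_⟩
  · rw [← sub_nonneg, hdiff k]
    exact RelSR.coeff_nonneg_of_one_sub_X_mul hnonneg k
  · rw [eq_comm, ← sub_eq_zero, hdiff k, RelSR.sum_weight_coeff_eq_zero_iff hnonneg]
    -- Faces of (T, D) are exactly the non-faces of Δ supported on no Γ i; dim σ < k means |σ| ≤ k,
    -- the negation of k < |σ|.
    simp only [RelSR.mem_relFinset, LowerSet.mem_sup_iff, Finset.sup_univ_eq_iSup,
      LowerSet.mem_iSup_iff, RelSR.mem_simplex, not_or, RelSR.IsNonFace]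
    constructor
    · intro h σ hσ hk
      by_contra hcon
      have := h σ ⟨hσ.1, hσ.2, hcon⟩
      omega
    · intro h σ hσ
      by_contra hk
      exact hσ.2.2 (h σ ⟨hσ.1, hσ.2.1⟩ (by omega))
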